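/- Let $\tau\in\mathbb{R}$ and $H\in\mathbb{R}$ with $0<|H|<\tfrac12$, let $d=\pm\sqrt{1-4H^2}$ (one fixed choice of sign, used throughout), and set $$P(s)=1-(d+2Hs+s)(d+2Hs-s),\qquad s_0=\frac{2H}{d}.$$ Consider $\mathbb{E}(-1,\tau)$ in the half-space model $\{(x,y,t):y>0\}$ with metric $\frac{dx^2+dy^2}{y^2}+\left(dt-\frac{2\tau}{y}dx\right)^2$. For a $C^2$ function $u$ of $s=x/y$, the graph $t=u(x/y)$ is invariant under the hyperbolic translations $(x,y,t)\mapsto(cx,cy,t)$, $c>0$, and with $w=u'$ its mean curvature with respect to the upward unit normal is $$\mathcal{M}_u(s)=\frac{\left[s^2(4\tau^2+1)+1\right]w'(s)+s\,w(s)\left[(s^2+1)w(s)^2-6\tau w(s)+8\tau^2+2\right]}{2\left[(s^2+1)w(s)^2-4\tau w(s)+4\tau^2+1\right]^{3/2}}.$$ Such a graph is called an $H$-graph if its mean curvature is $H$ with respect to the unit normal that points upward when $H>0$ and downward when $H<0$, that is, if $\operatorname{sign}(H)\,\mathcal{M}_u=H$. Define $$u_{d,+}^H(s)=2\tau\arctan(s)+\operatorname{sign}(H)\int_{s_0+1}^{s}\frac{\sqrt{4r^2\tau^2+r^2+1}\,(d+2Hr)}{(r^2+1)\sqrt{P(r)}}\,dr\qquad(s>s_0),$$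 $$u_{d,-}^H(s)=2\tau\arctan(s)+\operatorname{sign}(H)\int_{s_0-1}^{s}\frac{\sqrt{4r^2\tau^2+r^2+1}\,(d+2Hr)}{(r^2+1)\sqrt{P(r)}}\,dr\qquad(s<s_0).$$ Then $s_0$ is the only real root of $P$; the functions $u_{d,-}^H$ on $(-\infty,s_0)$ and $u_{d,+}^H$ on $(s_0,\infty)$ are $C^2$ and define $H$-graphs; and $$\lim_{s\to s_0^-}u_{d,-}^H(s)=\pm\operatorname{sign}(H)\,\infty\qquad\text{and}\qquad\lim_{s\to s_0^+}u_{d,+}^H(s)=\mp\operatorname{sign}(H)\,\infty,$$ where the upper signs hold for $d=\sqrt{1-4H^2}$ and the lower signs for $d=-\sqrt{1-4H^2}$. -/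

import Mathlib

open Set Filter Topology

noncomputable section

namespace HypInvariant

/-- The polynomial `P(s)` under the square root in the slope of the invariant graphs. -/
def P (H d s : ℝ) : ℝ := 1 - (d + 2 * H * s + s) * (d + 2 * H * s - s)

/-- The root of `P` in the critical case `d = ±√(1 - 4H²)`. -/
def s₀ (H d : ℝ) : ℝ := 2 * H / d

/-- The integrand in the formula for the invariant graphs. -/
def integrand (τ H d t : ℝ) : ℝ :=
  √(4 * t ^ 2 * τ ^ 2 + t ^ 2 + 1) * (d + 2 * H * t) / ((t ^ 2 + 1) * √(P H d t))

/-- The function `u_{d,+}^H`, considered on `(s₀, ∞)`. -/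
def uPlus (τ H d s : ℝ) : ℝ :=
  2 * τ * Real.arctan s + Real.sign H * ∫ t in (s₀ H d + 1)..s, integrand τ H d t

/-- The function `u_{d,-}^H`, considered on `(-∞, s₀)`. -/
def uMinus (τ H d s : ℝ) : ℝ :=
  2 * τ * Real.arctan s + Real.sign H * ∫ t in (s₀ H d - 1)..s, integrand τ H d t

/-- The mean curvature, with respect to the upward unit normal, of the surface
`t = u (x / y)` in the half-space model `{y > 0} × ℝ` of `𝔼(-1, τ)`, at the points with
`x / y = s`.  The model carries the metric `(dx² + dy²) / y² + (dt - 2 τ dx / y)²`. -/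
def upwardMeanCurvature (τ : ℝ) (u : ℝ → ℝ) (s : ℝ) : ℝ :=
  ((s ^ 2 * (4 * τ ^ 2 + 1) + 1) * deriv (deriv u) s
      + s * deriv u s * ((s ^ 2 + 1) * deriv u s ^ 2 - 6 * τ * deriv u s + 8 * τ ^ 2 + 2))
    / (2 * ((s ^ 2 + 1) * deriv u s ^ 2 - 4 * τ * deriv u s + 4 * τ ^ 2 + 1) ^ (3 / 2 : ℝ))

/-- On the open interval `I`, the surface `t = u (x / y)` is a `C²` graph of constant mean
curvature `H`, where the unit normal points upward if `H > 0` and downward if `H < 0`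
(reversing the normal changes the sign of the mean curvature). -/
def IsInvariantHGraphOn (τ H : ℝ) (u : ℝ → ℝ) (I : Set ℝ) : Prop :=
  ContDiffOn ℝ 2 u I ∧ ∀ s ∈ I, Real.sign H * upwardMeanCurvature τ u s = H

end HypInvariant

end

/-!
Since `d² + 4H² = 1`, the polynomial `P` is the perfect square `(d s - 2H)²`, so its only root
is `s₀ = 2H / d` and the integrand is smooth on either side of `s₀`.

Write `σ = sign H`, `g = d + 2Hs`, `A = √((4τ² + 1) s² + 1)`, `Q = √P`.  Both functions have slope
`w = (2τ + σ A g / Q) / (s² + 1)`.  As `Q² = 1 + s² - g²`, the quantity under the power `3/2` in the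
mean curvature is the square of `A / Q`, and the equation of constant mean curvature becomes an
algebraic identity (`slope_curvature_identity`) that uses no more than `A² = (4τ² + 1) s² + 1`,
`Q² = 1 + s² - g²`, `g' = 2H` and `σ² = 1`.

At `s₀` one has `g = 1 / d`, which has the sign `ε` of `d`, whereas `√P = |d| |s - s₀|`.  Hence
`ε * integrand` behaves like a positive multiple of `1 / |s - s₀|`, and its primitives diverge
logarithmically (`tendsto_integral_atTop_of_simple_pole_left` and its mirror image).
-/

namespace HypInvariant

/-! ### Primitives of functions with a simple pole -/

/-- The divergence is obtained by comparison with the primitive `-c * log (b - s)` of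
`c / (b - s)`. -/
theorem tendsto_integral_atTop_of_simple_pole_left {f : ℝ → ℝ} {a b L : ℝ} (hab : a < b)
    (hf : ContinuousOn f (Iio b)) (hL : 0 < L)
    (hlim : Tendsto (fun t => (b - t) * f t) (𝓝[<] b) (𝓝 L)) :
    Tendsto (fun s => ∫ t in a..s, f t) (𝓝[<] b) atTop := by
  have hev : ∀ᶠ t in 𝓝[<] b, L / 2 < (b - t) * f t := hlim.eventually_const_lt (by linarith)
  obtain ⟨l, hl, hlb⟩ := (mem_nhdsLT_iff_exists_Ioo_subset).1 hev
  obtain ⟨m, hlm, hmb⟩ := exists_between (show l < b from hl)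
  have hint : ∀ p q : ℝ, p < b → q < b → IntervalIntegrable f MeasureTheory.volume p q :=
    fun p q hp hq => (hf.mono fun x hx => lt_of_le_of_lt hx.2 (max_lt hp hq)).intervalIntegrable
  have hlog : Tendsto (fun s => Real.log (b - s)) (𝓝[<] b) atBot := by
    refine Real.tendsto_log_nhdsGT_zero.comp (tendsto_nhdsWithin_iff.2 ⟨?_, ?_⟩)
    · have : Tendsto (fun s => b - s) (𝓝 b) (𝓝 (b - b)) :=
        tendsto_const_nhds.sub tendsto_id
      rw [sub_self] at this
      exact this.mono_left nhdsWithin_le_nhds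
    · filter_upwards [self_mem_nhdsWithin] with s hs
      exact sub_pos.2 (mem_Iio.1 hs)
  have hcmp : Tendsto (fun s => ((∫ t in a..m, f t) + L / 2 * Real.log (b - m))
      + (-(L / 2)) * Real.log (b - s)) (𝓝[<] b) atTop :=
    tendsto_atTop_add_const_left _ _ (hlog.const_mul_atBot_of_neg (by linarith))
  refine tendsto_atTop_mono' _ ?_ hcmp
  filter_upwards [Ioo_mem_nhdsLT hmb] with s hs
  have hs2 : s < b := hs.2
  have hmono : ∫ t in m..s, L / 2 * (b - t)⁻¹ ≤ ∫ t in m..s, f t := by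
    refine intervalIntegral.integral_mono_on hs.1.le ?_ (hint m s hmb hs2) ?_
    · refine ContinuousOn.intervalIntegrable (continuousOn_const.mul
        (ContinuousOn.inv₀ (by fun_prop) fun t ht => ?_))
      rw [uIcc_of_le hs.1.le] at ht
      linarith [ht.2]
    · intro t ht
      have h1 : 0 < b - t := by linarith [ht.2]
      have h2 : L / 2 < (b - t) * f t := hlb ⟨by linarith [ht.1], by linarith⟩
      rw [← div_eq_mul_inv, div_le_iff₀ h1]
      linarith
  have hval : ∫ t in m..s, L / 2 * (b - t)⁻¹
      = L / 2 * (Real.log (b - m) - Real.log (b - s)) := by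
    rw [intervalIntegral.integral_const_mul,
      intervalIntegral.integral_comp_sub_left (fun x => x⁻¹) b,
      integral_inv_of_pos (by linarith) (by linarith),
      Real.log_div (by linarith) (by linarith)]
  have hsplit := intervalIntegral.integral_add_adjacent_intervals
    (hint a m hab hmb) (hint m s hmb hs2)
  linarith

theorem tendsto_integral_atBot_of_simple_pole_right {f : ℝ → ℝ} {a b L : ℝ} (hab : b < a)
    (hf : ContinuousOn f (Ioi b)) (hL : 0 < L)
    (hlim : Tendsto (fun t => (t - b) * f t) (𝓝[>] b) (𝓝 L)) :
    Tendsto (fun s => ∫ t in a..s, f t) (𝓝[>] b) atBot := by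
  have hneg : Tendsto (fun t : ℝ => -t) (𝓝[<] (-b)) (𝓝[>] b) := by
    simpa using tendsto_neg_nhdsLT (a := -b)
  have key := tendsto_integral_atTop_of_simple_pole_left (f := fun t => f (-t)) (a := -a)
    (b := -b) (neg_lt_neg hab) (hf.comp (by fun_prop) fun t ht => by
      simp only [mem_Iio, mem_Ioi] at *; linarith) hL
    ((hlim.comp hneg).congr fun t => by simp only [Function.comp_apply]; ring)
  have hneg' : Tendsto (fun t : ℝ => -t) (𝓝[>] b) (𝓝[<] (-b)) := tendsto_neg_nhdsGT
  refine (tendsto_neg_atTop_atBot.comp (key.comp hneg')).congr fun s => ?_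
  simp only [Function.comp_apply, intervalIntegral.integral_comp_neg, neg_neg]
  exact (intervalIntegral.integral_symm _ _).symm

/-! ### The polynomial and the integrand -/

theorem P_eq_sq {H d : ℝ} (hd : d ^ 2 = 1 - 4 * H ^ 2) (s : ℝ) :
    P H d s = (d * s - 2 * H) ^ 2 := by
  unfold P
  linear_combination (-1 - s ^ 2) * hd

theorem P_eq_zero_iff {H d : ℝ} (hd : d ^ 2 = 1 - 4 * H ^ 2) (hd0 : d ≠ 0) (s : ℝ) :
    P H d s = 0 ↔ s = s₀ H d := by
  rw [P_eq_sq hd, s₀, eq_div_iff hd0, sq_eq_zero_iff, sub_eq_zero, mul_comm]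

theorem P_pos {H d : ℝ} (hd : d ^ 2 = 1 - 4 * H ^ 2) (hd0 : d ≠ 0) {s : ℝ} (hs : s ≠ s₀ H d) :
    0 < P H d s :=
  lt_of_le_of_ne (P_eq_sq hd s ▸ sq_nonneg _) fun h => hs ((P_eq_zero_iff hd hd0 s).1 h.symm)

theorem sqrt_P {H d : ℝ} (hd : d ^ 2 = 1 - 4 * H ^ 2) (hd0 : d ≠ 0) (s : ℝ) :
    √(P H d s) = |d| * |s - s₀ H d| := by
  rw [P_eq_sq hd, Real.sqrt_sq_eq_abs, ← abs_mul, s₀]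
  congr 1
  field_simp

theorem contDiffAt_integrand (τ : ℝ) {H d s : ℝ} (hP : 0 < P H d s) :
    ContDiffAt ℝ 1 (integrand τ H d) s := by
  have hA : 4 * s ^ 2 * τ ^ 2 + s ^ 2 + 1 ≠ 0 := by positivity
  have hs : (s ^ 2 + 1) * √(P H d s) ≠ 0 := by positivity
  have hPc : ContDiffAt ℝ 1 (P H d) s := by unfold P; fun_prop
  have hAc : ContDiffAt ℝ 1 (fun t : ℝ => √(4 * t ^ 2 * τ ^ 2 + t ^ 2 + 1)) s :=
    ContDiffAt.sqrt (by fun_prop) hA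
  have hgc : ContDiffAt ℝ 1 (fun t : ℝ => d + 2 * H * t) s := by fun_prop
  have hDc : ContDiffAt ℝ 1 (fun t : ℝ => t ^ 2 + 1) s := by fun_prop
  exact (hAc.mul hgc).div (hDc.mul (hPc.sqrt hP.ne')) hs

/-! ### The mean curvature equation -/

/-- The slope of the graphs, the common derivative of `uMinus` and `uPlus`. -/
noncomputable def slope (τ H d s : ℝ) : ℝ :=
  2 * τ * (1 / (1 + s ^ 2)) + Real.sign H * integrand τ H d s

theorem sign_sq {H : ℝ} (hH : H ≠ 0) : Real.sign H ^ 2 = 1 := by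
  rcases Real.sign_apply_eq_of_ne_zero H hH with h | h <;> simp [h]

/-- The mean curvature equation in algebraic form: `A`, `Q`, `g` stand for the two square roots
and the linear factor of the integrand at `s`, and the bracket multiplied by `A ^ 2` is the
derivative of the slope. -/
theorem slope_curvature_identity {τ H s A Q g σ w : ℝ} (hA : 0 < A) (hQ : 0 < Q)
    (hA2 : A ^ 2 = 4 * s ^ 2 * τ ^ 2 + s ^ 2 + 1) (hQ2 : Q ^ 2 = 1 + s ^ 2 - g ^ 2)
    (hσ : σ ^ 2 = 1) (hw : w = (2 * τ + σ * (A * g / Q)) / (s ^ 2 + 1)) :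
    A ^ 2 * ((σ * (s * (4 * τ ^ 2 + 1) / A * g / Q + A * (2 * H) / Q
        - A * g * ((s - 2 * H * g) / Q) / Q ^ 2)) / (s ^ 2 + 1)
        - 2 * s * (2 * τ + σ * (A * g / Q)) / (s ^ 2 + 1) ^ 2)
      + s * w * ((s ^ 2 + 1) * w ^ 2 - 6 * τ * w + 8 * τ ^ 2 + 2)
      = 2 * (σ * H) * (A / Q) ^ 3 := by
  set z := σ * (A * g / Q) with hz
  have hD : s ^ 2 + 1 ≠ 0 := by positivity
  have hX : (A / Q) ^ 2 * (s ^ 2 + 1) = z ^ 2 + A ^ 2 := by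
    have hq : (A / Q) ^ 2 * Q ^ 2 = A ^ 2 := by field_simp
    have hg : z ^ 2 = (A / Q) ^ 2 * g ^ 2 := by rw [hz, mul_pow, hσ]; ring
    linear_combination hq - hg - (A / Q) ^ 2 * hQ2
  have hX' : (A / Q) ^ 2 = (z ^ 2 + A ^ 2) / (s ^ 2 + 1) := by rw [← hX]; field_simp
  -- The terms with `H` add up to the right-hand side; all the others cancel (`hrest`).
  have hHterms : σ * (A / Q) * (2 * H) * A ^ 2 * (1 + g ^ 2 / Q ^ 2) / (s ^ 2 + 1)
      = 2 * (σ * H) * (A / Q) ^ 3 := by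
    have : 1 + g ^ 2 / Q ^ 2 = (s ^ 2 + 1) / Q ^ 2 := by
      field_simp
      linear_combination hQ2
    rw [this]
    field_simp
  have hexpand : A ^ 2 * ((σ * (s * (4 * τ ^ 2 + 1) / A * g / Q + A * (2 * H) / Q
        - A * g * ((s - 2 * H * g) / Q) / Q ^ 2)) / (s ^ 2 + 1)
        - 2 * s * (2 * τ + z) / (s ^ 2 + 1) ^ 2)
      = σ * (A / Q) * (2 * H) * A ^ 2 * (1 + g ^ 2 / Q ^ 2) / (s ^ 2 + 1)
        + z * s * ((4 * τ ^ 2 + 1) - (A / Q) ^ 2) / (s ^ 2 + 1)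
        - 2 * s * A ^ 2 * (2 * τ + z) / (s ^ 2 + 1) ^ 2 := by
    rw [hz]
    field_simp
    ring
  have hrest : z * s * ((4 * τ ^ 2 + 1) - (A / Q) ^ 2) / (s ^ 2 + 1)
        - 2 * s * A ^ 2 * (2 * τ + z) / (s ^ 2 + 1) ^ 2
      + s * w * ((s ^ 2 + 1) * w ^ 2 - 6 * τ * w + 8 * τ ^ 2 + 2) = 0 := by
    rw [hX', hw, hA2]
    field_simp
    ring
  rw [hexpand, hHterms]
  linear_combination hrest

/-- The quantity under the power `3 / 2` in the mean curvature, by completing the square in `w`. -/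
theorem slope_area_identity {τ s A Q g σ w : ℝ} (hQ : 0 < Q)
    (hA2 : A ^ 2 = 4 * s ^ 2 * τ ^ 2 + s ^ 2 + 1) (hQ2 : Q ^ 2 = 1 + s ^ 2 - g ^ 2)
    (hσ : σ ^ 2 = 1) (hw : w = (2 * τ + σ * (A * g / Q)) / (s ^ 2 + 1)) :
    (s ^ 2 + 1) * w ^ 2 - 4 * τ * w + 4 * τ ^ 2 + 1 = (A / Q) ^ 2 := by
  have hs : s ^ 2 + 1 ≠ 0 := by positivity
  have hz : (s ^ 2 + 1) * w - 2 * τ = σ * (A * g / Q) := by rw [hw]; field_simp; ring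
  have hq : (A / Q) ^ 2 * Q ^ 2 = A ^ 2 := by field_simp
  have hg : (σ * (A * g / Q)) ^ 2 = (A / Q) ^ 2 * g ^ 2 := by
    rw [mul_pow, hσ]; ring
  apply mul_left_cancel₀ hs
  linear_combination ((s ^ 2 + 1) * w - 2 * τ + σ * (A * g / Q)) * hz + hg - hA2 - hq
    + (A / Q) ^ 2 * hQ2

theorem slope_eq (τ H d s : ℝ) :
    slope τ H d s = (2 * τ + Real.sign H * (√(4 * s ^ 2 * τ ^ 2 + s ^ 2 + 1) * (d + 2 * H * s)
      / √(P H d s))) / (s ^ 2 + 1) := by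
  have hs : s ^ 2 + 1 ≠ 0 := by positivity
  unfold slope integrand
  rw [add_comm 1 (s ^ 2), div_mul_eq_div_div_swap]
  ring

theorem hasDerivAt_slope (τ : ℝ) {H d s : ℝ} (hP : 0 < P H d s) :
    let A := √(4 * s ^ 2 * τ ^ 2 + s ^ 2 + 1)
    let Q := √(P H d s)
    let g := d + 2 * H * s
    HasDerivAt (slope τ H d)
      ((Real.sign H * (s * (4 * τ ^ 2 + 1) / A * g / Q + A * (2 * H) / Q
        - A * g * ((s - 2 * H * g) / Q) / Q ^ 2)) / (s ^ 2 + 1)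
        - 2 * s * (2 * τ + Real.sign H * (A * g / Q)) / (s ^ 2 + 1) ^ 2) s := by
  intro A Q g
  have hs : s ^ 2 + 1 ≠ 0 := by positivity
  have hA0 : 4 * s ^ 2 * τ ^ 2 + s ^ 2 + 1 ≠ 0 := by positivity
  have hApos : 0 < A := Real.sqrt_pos.2 (by positivity)
  have hQpos : 0 < Q := Real.sqrt_pos.2 hP
  have hsq : HasDerivAt (fun x : ℝ => x ^ 2) (2 * s) s := by
    simpa using hasDerivAt_pow 2 s
  have hid := hasDerivAt_id' s
  have hA : HasDerivAt (fun x => √(4 * x ^ 2 * τ ^ 2 + x ^ 2 + 1))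
      (s * (4 * τ ^ 2 + 1) / A) s := by
    refine ((((hsq.const_mul 4).mul_const (τ ^ 2)).add hsq).add_const 1).sqrt hA0
      |>.congr_deriv ?_
    change _ / (2 * A) = _
    field_simp
  have hg : HasDerivAt (fun x => d + 2 * H * x) (2 * H) s := by
    simpa using (hid.const_mul (2 * H)).const_add d
  have hQ : HasDerivAt (fun x => √(P H d x)) ((s - 2 * H * g) / Q) s := by
    have h1 : HasDerivAt (P H d) (2 * (s - 2 * H * g)) s := by
      refine (((hg.add hid).mul (hg.sub hid)).const_sub 1).congr_deriv ?_
      simp only [g, Pi.add_apply, Pi.sub_apply]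
      ring
    refine (h1.sqrt hP.ne').congr_deriv ?_
    change _ / (2 * Q) = _
    field_simp
  rw [funext (slope_eq τ H d)]
  refine (((((hA.mul hg).div hQ hQpos.ne').const_mul (Real.sign H)).const_add (2 * τ)).div
    (hsq.add_const 1) hs).congr_deriv ?_
  change ((Real.sign H * ((((s * (4 * τ ^ 2 + 1) / A) * g + A * (2 * H)) * Q
    - A * g * ((s - 2 * H * g) / Q)) / Q ^ 2)) * (s ^ 2 + 1)
    - (2 * τ + Real.sign H * (A * g / Q)) * (2 * s)) / (s ^ 2 + 1) ^ 2 = _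
  field_simp

/-- The argument applies to any base point `a` of the primitive and to any interval `I` that avoids
the root of `P`. -/
theorem isInvariantHGraphOn_primitive (τ : ℝ) {H d a : ℝ} {I : Set ℝ} (hH : H ≠ 0)
    (hI : IsOpen I) (hI' : I.OrdConnected) (ha : a ∈ I) (hP : ∀ s ∈ I, 0 < P H d s) :
    IsInvariantHGraphOn τ H
      (fun s => 2 * τ * Real.arctan s + Real.sign H * ∫ t in a..s, integrand τ H d t) I := by
  set u : ℝ → ℝ :=
    fun s => 2 * τ * Real.arctan s + Real.sign H * ∫ t in a..s, integrand τ H d t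
  have hcont : ContinuousOn (integrand τ H d) I := fun s hs =>
    (contDiffAt_integrand τ (hP s hs)).continuousAt.continuousWithinAt
  have hderiv : ∀ s ∈ I, HasDerivAt u (slope τ H d s) s := by
    intro s hs
    have h1 : HasDerivAt (fun s => ∫ t in a..s, integrand τ H d t) (integrand τ H d s) s :=
      intervalIntegral.integral_hasDerivAt_right
        ((hcont.mono (hI'.uIcc_subset ha hs)).intervalIntegrable)
        (hcont.stronglyMeasurableAtFilter hI s hs)
        (contDiffAt_integrand τ (hP s hs)).continuousAt
    exact ((Real.hasDerivAt_arctan s).const_mul (2 * τ)).add (h1.const_mul (Real.sign H))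
  have hslope : ContDiffOn ℝ 1 (slope τ H d) I := fun s hs => by
    refine ContDiffAt.contDiffWithinAt (ContDiffAt.add (contDiffAt_const.mul
      (contDiffAt_const.div (by fun_prop) ?_)) (contDiffAt_const.mul
      (contDiffAt_integrand τ (hP s hs))))
    positivity
  refine ⟨?_, fun s hs => ?_⟩
  · rw [show (2 : WithTop ℕ∞) = 1 + 1 by norm_num, contDiffOn_succ_iff_deriv_of_isOpen hI]
    refine ⟨fun s hs => (hderiv s hs).differentiableAt.differentiableWithinAt, by simp, ?_⟩
    exact hslope.congr fun s hs => (hderiv s hs).deriv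
  · have h2 : deriv (deriv u) s = deriv (slope τ H d) s :=
      Filter.EventuallyEq.deriv_eq <| by
        filter_upwards [hI.mem_nhds hs] with x hx using (hderiv x hx).deriv
    have hApos : 0 < √(4 * s ^ 2 * τ ^ 2 + s ^ 2 + 1) := Real.sqrt_pos.2 (by positivity)
    have hQpos : 0 < √(P H d s) := Real.sqrt_pos.2 (hP s hs)
    have hA2 := Real.sq_sqrt (show 0 ≤ 4 * s ^ 2 * τ ^ 2 + s ^ 2 + 1 by positivity)
    have hQ2 : √(P H d s) ^ 2 = 1 + s ^ 2 - (d + 2 * H * s) ^ 2 := by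
      rw [Real.sq_sqrt (hP s hs).le, P]; ring
    have hσ := sign_sq hH
    unfold upwardMeanCurvature
    rw [h2, (hderiv s hs).deriv, (hasDerivAt_slope τ (hP s hs)).deriv,
      slope_area_identity hQpos hA2 hQ2 hσ (slope_eq τ H d s),
      show s ^ 2 * (4 * τ ^ 2 + 1) + 1 = √(4 * s ^ 2 * τ ^ 2 + s ^ 2 + 1) ^ 2 by
        rw [hA2]; ring,
      slope_curvature_identity hApos hQpos hA2 hQ2 hσ (slope_eq τ H d s)]
    set R := √(4 * s ^ 2 * τ ^ 2 + s ^ 2 + 1) / √(P H d s) with hR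
    have hRpos : 0 < R := div_pos hApos hQpos
    have hpow : (R ^ 2) ^ (3 / 2 : ℝ) = R ^ 3 := by
      rw [← Real.rpow_natCast R 2, ← Real.rpow_mul hRpos.le, ← Real.rpow_natCast R 3]
      norm_num
    rw [hpow]
    field_simp
    linear_combination hσ

/-! ### The behaviour at the root of `P` -/

/-- At `s₀` the factor `d + 2 * H * s` equals `1 / d`, so the limit below has the sign of `d`. -/
theorem tendsto_abs_sub_mul_integrand (τ : ℝ) {H d : ℝ} (hd : d ^ 2 = 1 - 4 * H ^ 2)
    (hd0 : d ≠ 0) :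
    Tendsto (fun t => |t - s₀ H d| * integrand τ H d t) (𝓝[≠] (s₀ H d))
      (𝓝 (√(4 * s₀ H d ^ 2 * τ ^ 2 + s₀ H d ^ 2 + 1) / ((s₀ H d ^ 2 + 1) * (d * |d|)))) := by
  set b := s₀ H d with hb
  have hval : √(4 * b ^ 2 * τ ^ 2 + b ^ 2 + 1) / ((b ^ 2 + 1) * (d * |d|))
      = √(4 * b ^ 2 * τ ^ 2 + b ^ 2 + 1) * (d + 2 * H * b) / ((b ^ 2 + 1) * |d|) := by
    have h1 : d + 2 * H * b = 1 / d := by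
      rw [hb, s₀]
      field_simp
      linear_combination hd
    have : b ^ 2 + 1 ≠ 0 := by positivity
    have : |d| ≠ 0 := abs_ne_zero.2 hd0
    rw [h1]
    field_simp
  have hc : ContinuousAt (fun t => √(4 * t ^ 2 * τ ^ 2 + t ^ 2 + 1) * (d + 2 * H * t)
      / ((t ^ 2 + 1) * |d|)) b := by
    refine ContinuousAt.div (by fun_prop) (by fun_prop) ?_
    have := abs_pos.2 hd0
    positivity
  rw [hval]
  refine (hc.tendsto.mono_left nhdsWithin_le_nhds).congr' ?_
  filter_upwards [self_mem_nhdsWithin] with t ht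
  have h1 : |t - b| ≠ 0 := abs_ne_zero.2 (sub_ne_zero.2 ht)
  have h2 : |d| ≠ 0 := abs_ne_zero.2 hd0
  have h3 : t ^ 2 + 1 ≠ 0 := by positivity
  rw [integrand, sqrt_P hd hd0, ← hb]
  field_simp

theorem tendsto_coe_sign_mul_top {α : Type*} {l : Filter α} {f g : α → ℝ} {k c : ℝ}
    (hk : k = 1 ∨ k = -1) (hg : Tendsto g l (𝓝 c)) (hf : Tendsto f l atTop) :
    Tendsto (fun x => ((g x + k * f x : ℝ) : EReal)) l (𝓝 ((k : EReal) * ⊤)) := by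
  rcases hk with rfl | rfl
  · rw [EReal.coe_mul_top_of_pos one_pos, EReal.tendsto_coe_nhds_top_iff]
    simpa using hg.add_atTop hf
  · rw [EReal.coe_mul_top_of_neg (by norm_num), EReal.tendsto_coe_nhds_bot_iff]
    simpa using hg.add_atBot (tendsto_neg_atTop_atBot.comp hf)

end HypInvariant

theorem proposition3p1 (τ H ε d : ℝ) (hH0 : H ≠ 0) (hH : |H| < 1 / 2)
    (hε : ε = 1 ∨ ε = -1) (hd : d = ε * √(1 - 4 * H ^ 2)) :
    (∀ s : ℝ, HypInvariant.P H d s = 0 ↔ s = HypInvariant.s₀ H d) ∧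
    HypInvariant.IsInvariantHGraphOn τ H (HypInvariant.uMinus τ H d)
      (Iio (HypInvariant.s₀ H d)) ∧
    HypInvariant.IsInvariantHGraphOn τ H (HypInvariant.uPlus τ H d)
      (Ioi (HypInvariant.s₀ H d)) ∧
    Tendsto (fun s : ℝ => ((HypInvariant.uMinus τ H d s : ℝ) : EReal))
      (𝓝[<] (HypInvariant.s₀ H d)) (𝓝 (((ε * Real.sign H : ℝ) : EReal) * ⊤)) ∧
    Tendsto (fun s : ℝ => ((HypInvariant.uPlus τ H d s : ℝ) : EReal))
      (𝓝[>] (HypInvariant.s₀ H d)) (𝓝 (((-(ε * Real.sign H) : ℝ) : EReal) * ⊤)) := by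
  have hd2 : d ^ 2 = 1 - 4 * H ^ 2 := by
    have h : 0 ≤ 1 - 4 * H ^ 2 := by nlinarith [sq_abs H, abs_nonneg H]
    rw [hd, mul_pow, Real.sq_sqrt h]
    rcases hε with rfl | rfl <;> norm_num
  have hεd : 0 < ε * d := by
    have h : 0 < √(1 - 4 * H ^ 2) := Real.sqrt_pos.2 (by nlinarith [sq_abs H, abs_nonneg H])
    rw [hd]
    rcases hε with rfl | rfl <;> simpa using h
  have hd0 : d ≠ 0 := right_ne_zero_of_mul hεd.ne'
  have hε2 : ε * ε = 1 := by rcases hε with rfl | rfl <;> norm_num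
  have hk : ε * Real.sign H = 1 ∨ ε * Real.sign H = -1 := by
    rcases hε with rfl | rfl <;> rcases Real.sign_apply_eq_of_ne_zero H hH0 with h | h <;> simp [h]
  have hP : ∀ s, s ≠ HypInvariant.s₀ H d → 0 < HypInvariant.P H d s :=
    fun s hs => HypInvariant.P_pos hd2 hd0 hs
  have hcont : ContinuousOn (fun t => ε * HypInvariant.integrand τ H d t)
      {HypInvariant.s₀ H d}ᶜ := fun s hs =>
    (continuousAt_const.mul
      (HypInvariant.contDiffAt_integrand τ (hP s hs)).continuousAt).continuousWithinAt
  have hlim := (HypInvariant.tendsto_abs_sub_mul_integrand τ hd2 hd0).const_mul ε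
  set b := HypInvariant.s₀ H d with hb
  have hL : 0 < ε * (√(4 * b ^ 2 * τ ^ 2 + b ^ 2 + 1) / ((b ^ 2 + 1) * (d * |d|))) := by
    have h1 : 0 < √(4 * b ^ 2 * τ ^ 2 + b ^ 2 + 1) := Real.sqrt_pos.2 (by positivity)
    have h2 : 0 < |d| := abs_pos.2 hd0
    -- `ε = 1 / ε` moves `ε` into the denominator, next to `d`.
    have h3 : ε * (√(4 * b ^ 2 * τ ^ 2 + b ^ 2 + 1) / ((b ^ 2 + 1) * (d * |d|)))
        = √(4 * b ^ 2 * τ ^ 2 + b ^ 2 + 1) / ((b ^ 2 + 1) * (ε * d * |d|)) := by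
      have : ε ≠ 0 := left_ne_zero_of_mul hεd.ne'
      field_simp
      linear_combination hε2
    rw [h3]
    positivity
  have harctan : ContinuousAt (fun s => 2 * τ * Real.arctan s) b := by fun_prop
  refine ⟨HypInvariant.P_eq_zero_iff hd2 hd0,
    HypInvariant.isInvariantHGraphOn_primitive τ hH0 isOpen_Iio ordConnected_Iio
      (by simp [hb]) (fun s hs => hP s (ne_of_lt hs)),
    HypInvariant.isInvariantHGraphOn_primitive τ hH0 isOpen_Ioi ordConnected_Ioi
      (by simp [hb]) (fun s hs => hP s (ne_of_gt hs)), ?_, ?_⟩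
  · have hdiv := HypInvariant.tendsto_integral_atTop_of_simple_pole_left (sub_one_lt b)
      (hcont.mono fun s hs => ne_of_lt hs) hL
      ((hlim.mono_left (nhdsWithin_mono b fun s hs => ne_of_lt hs)).congr' (by
        filter_upwards [self_mem_nhdsWithin] with t ht
        rw [abs_of_neg (sub_neg.2 ht)]
        ring))
    refine (HypInvariant.tendsto_coe_sign_mul_top hk
      (harctan.tendsto.mono_left nhdsWithin_le_nhds) hdiv).congr fun s => ?_
    rw [HypInvariant.uMinus, intervalIntegral.integral_const_mul, ← hb, EReal.coe_eq_coe_iff]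
    linear_combination (Real.sign H * ∫ t in (b - 1)..s, HypInvariant.integrand τ H d t) * hε2
  · have hdiv := HypInvariant.tendsto_integral_atBot_of_simple_pole_right (lt_add_one b)
      (hcont.mono fun s hs => ne_of_gt hs) hL
      ((hlim.mono_left (nhdsWithin_mono b fun s hs => ne_of_gt hs)).congr' (by
        filter_upwards [self_mem_nhdsWithin] with t ht
        rw [abs_of_pos (sub_pos.2 ht)]
        ring))
    have hk' : -(ε * Real.sign H) = 1 ∨ -(ε * Real.sign H) = -1 := by
      rcases hk with h | h <;> simp [h]
    refine (HypInvariant.tendsto_coe_sign_mul_top hk'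
      (harctan.tendsto.mono_left nhdsWithin_le_nhds)
      (tendsto_neg_atBot_atTop.comp hdiv)).congr fun s => ?_
    rw [Function.comp_apply, HypInvariant.uPlus, intervalIntegral.integral_const_mul, ← hb,
      EReal.coe_eq_coe_iff]
    linear_combination (Real.sign H * ∫ t in (b + 1)..s, HypInvariant.integrand τ H d t) * hε2
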